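/- Graphs are finite and may have loops and multiple edges. For a graph $G$ with edge set $E(G)$, let $\mu(G)$ be the number of its connected components and $\beta(G)=|E(G)|-|V(G)|+\mu(G)$ its first Betti number, and put $$h(G)(x,y)=\sum_{F\subseteq E(G)}(-x)^{-|F|}\,x^{\mu(G-F)}\,y^{\beta(G-F)} .$$ The Yamada polynomial of $G$ is the Laurent polynomial $H(G)(A)=h(G)(-1,\,-A-2-A^{-1})$; it is the Yamada polynomial $R[G]$ of the plane diagram $G$ (without double points) when $G$ is a plane graph. For integers $n,s\ge 1$ let $C_n$ be the cycle with $n$ edges ($C_1$ is a loop, $C_2$ a pair of parallel edges), let $\Theta_s$ be the graph consisting of two vertices and $s$ edges between them, and let the "ring of beads" $C_n(\Theta_s)$ be the plane graph obtained from $C_n$ by replacing every edge of $C_n$ by a copy of $\Theta_s$, the two vertices of $\Theta_s$ being identified with the two ends of the edge. **Theorem.** The zeros of the Yamada polynomials $R[C_n(\Theta_s)]=H(C_n(\Theta_s))$, $n,s\ge 1$, are dense in the region $\{z\in\mathbb C\setminus\{0\} : |z+1+z^{-1}|\ge 1\}$: for every $z_0\in\mathbb C\setminus\{0\}$ with $|z_0+1+z_0^{-1}|\ge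 1$ and every $\varepsilon>0$ there are integers $n,s\ge 1$ and a $z\in\mathbb C\setminus\{0\}$ with $H(C_n(\Theta_s))(z)=0$ and $|z-z_0|<\varepsilon$. -/

import Mathlib

open scoped LaurentPolynomial

/-! Finite multigraphs, with loops and multiple edges allowed, are modelled by Mathlib's
`Graph α β` (vertices in `α`, edges in `β`). -/

namespace YamadaPolynomial

section Invariants

variable {α β : Type*}

/-- The number `μ(G)` of connected components of `G`: the number of classes of vertices under the
equivalence relation generated by adjacency. -/
noncomputable def numComponents (G : Graph α β) : ℕ :=
  Nat.card (Quot fun x y : G.vertexSet => G.Adj (x : α) (y : α))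

/-- The first Betti number `|E(G)| - |V(G)| + μ(G)` of a finite graph. The natural number
subtraction is not truncated, since `|V(G)| ≤ |E(G)| + μ(G)` for every finite graph. -/
noncomputable def bettiNumber (G : Graph α β) : ℕ :=
  G.edgeSet.ncard + numComponents G - G.vertexSet.ncard

/-- The two-variable Laurent polynomial
`h(G)(x, y) = ∑_{F ⊆ E(G)} (-x)^(-|F|) x^(μ(G - F)) y^(β(G - F))`, evaluated at an invertible
element `x` and an element `y` of an arbitrary commutative ring (`y` occurs only with nonnegative
exponents). Here `G - F` has the same vertices as `G`. -/
noncomputable def negamiPolynomial [Finite β] (G : Graph α β) {R : Type*} [CommRing R]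
    (x : Rˣ) (y : R) : R :=
  ∑ F ∈ (Set.toFinite G.edgeSet).toFinset.powerset,
    (((-x)⁻¹ ^ F.card : Rˣ) : R) * (x : R) ^ numComponents (G.deleteEdges (F : Set β)) *
      y ^ bettiNumber (G.deleteEdges (F : Set β))

/-- The Yamada polynomial `H(G)(A) = h(G)(-1, -A - 2 - A⁻¹)`, a Laurent polynomial in the
variable `A`, which is written `T 1` here. For a plane graph, that is, a diagram without double
points, this is the Yamada polynomial `R[G]` of the diagram: its only state is `G` itself, with
coefficient `A ^ 0 = 1`. -/
noncomputable def yamadaPolynomial [Finite β] (G : Graph α β) : ℤ[T;T⁻¹] :=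
  negamiPolynomial G (-1 : (ℤ[T;T⁻¹])ˣ)
    (-LaurentPolynomial.T 1 - 2 - LaurentPolynomial.T (-1))

/-- The zeros of the Yamada polynomial of `G` in the punctured plane `ℂ \ {0}`, where Laurent
polynomials can be evaluated. -/
def yamadaZeros [Finite β] (G : Graph α β) : Set ℂ :=
  {z | ∃ w : ℂˣ, (w : ℂ) = z ∧
    LaurentPolynomial.eval₂ (Int.castRingHom ℂ) w (yamadaPolynomial G) = 0}

end Invariants

section EdgeReplacement

variable {α β γ δ : Type*}

open Classical in
/-- The position, in a graph whose edges have been replaced by copies of a graph with attaching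
vertices `u` and `v`, of the vertex `w` of the copy that replaces the edge `e`: the vertex `u` is
identified with the end `src e` of `e`, the vertex `v` with the end `tgt e`, and every other vertex
is a new vertex. -/
noncomputable def attach (src tgt : β → α) (u v : γ) (e : β) (w : γ) : α ⊕ (β × γ) :=
  if w = u then Sum.inl (src e) else if w = v then Sum.inl (tgt e) else Sum.inr (e, w)

/-- The graph obtained from `G` by replacing every edge `e`, with ends `src e` and `tgt e`, by a
copy of the graph `K` with two distinct attaching vertices `u` and `v`; the copy replacing `e` is attached
along `u = src e` and `v = tgt e` and has only these vertices in common with the rest.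
(It is applied with `u ≠ v` only.) The edges are the pairs of an edge of `G` and an edge of `K`. -/
noncomputable def replaceEdges (G : Graph α β) (src tgt : β → α)
    (hG : ∀ e ∈ G.edgeSet, G.IsLink e (src e) (tgt e)) (K : Graph γ δ) (u v : γ) :
    Graph (α ⊕ (β × γ)) (β × δ) where
  vertexSet := Sum.inl '' G.vertexSet ∪
    Sum.inr '' {p : β × γ | p.1 ∈ G.edgeSet ∧ p.2 ∈ K.vertexSet ∧ p.2 ≠ u ∧ p.2 ≠ v}
  IsLink f p q := f.1 ∈ G.edgeSet ∧ ∃ x y, K.IsLink f.2 x y ∧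
    p = attach src tgt u v f.1 x ∧ q = attach src tgt u v f.1 y
  isLink_symm := by
    rintro f -
    exact ⟨fun p q ⟨he, x, y, hxy, hp, hq⟩ => ⟨he, y, x, hxy.symm, hq, hp⟩⟩
  eq_or_eq_of_isLink_of_isLink := by
    rintro f p q p' q' ⟨-, x, y, hxy, rfl, rfl⟩ ⟨-, x', y', hxy', rfl, rfl⟩
    rcases K.eq_or_eq_of_isLink_of_isLink hxy hxy' with h | h
    · exact Or.inl (by rw [h])
    · exact Or.inr (by rw [h])
  left_mem_of_isLink := by
    rintro f p q ⟨he, x, y, hxy, rfl, rfl⟩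
    unfold attach
    split_ifs with hu hv
    · exact Or.inl ⟨_, (hG _ he).left_mem, rfl⟩
    · exact Or.inl ⟨_, (hG _ he).right_mem, rfl⟩
    · exact Or.inr ⟨_, ⟨he, hxy.left_mem, hu, hv⟩, rfl⟩

end EdgeReplacement

/-- The cycle graph `C_n`, `n ≥ 1`: its vertices are `0, …, n - 1`, and its edge `i` joins `i` and
`i + 1` modulo `n`. Thus `C_1` is a loop and `C_2` consists of two parallel edges. -/
def cycleGraph (n : ℕ) : Graph (Fin n) (Fin n) where
  vertexSet := Set.univ
  edgeSet := Set.univ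
  IsLink i x y := (x = i ∧ y = finRotate n i) ∨ (x = finRotate n i ∧ y = i)
  isLink_symm := by
    rintro i -
    exact ⟨fun x y h => by tauto⟩
  eq_or_eq_of_isLink_of_isLink := by
    rintro i x y x' y' (⟨rfl, rfl⟩ | ⟨rfl, rfl⟩) (⟨rfl, rfl⟩ | ⟨rfl, rfl⟩) <;> simp
  edge_mem_iff_exists_isLink := fun i => by
    simp only [Set.mem_univ, true_iff]
    exact ⟨i, finRotate n i, Or.inl ⟨rfl, rfl⟩⟩
  left_mem_of_isLink := fun _ _ _ _ => Set.mem_univ _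

/-- The theta graph `Θ_s`: two vertices `0` and `1` and `s` edges between them. -/
def thetaGraph (s : ℕ) : Graph (Fin 2) (Fin s) :=
  Graph.banana 0 1 Set.univ

/-- The ring of beads `C_n(Θ_s)`: every edge of the cycle `C_n` is replaced by a copy of `Θ_s`,
attached along its two vertices. -/
noncomputable def ringOfBeads (n s : ℕ) :
    Graph (Fin n ⊕ (Fin n × Fin 2)) (Fin n × Fin s) :=
  replaceEdges (cycleGraph n) id (finRotate n) (fun _ _ => Or.inl ⟨rfl, rfl⟩) (thetaGraph s) 0 1

end YamadaPolynomial

/-!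
With `y = -A - 2 - A⁻¹` and `w = A + 1 + A⁻¹ = -(y + 1)`, the sum defining the Yamada polynomial is
a Potts partition function with `q = -y` states. A copy of `Θ_s` acts as a single edge, and the
transfer matrix of the cycle gives (`negami_ringOfBeads`)
`y ^ n H(C_n(Θ_s)) = ((-w) ^ s + w) ^ n + w ((-w) ^ s - 1) ^ n`.

Put `w = -e ^ L` with `0 < re L`, that is, `1 < ‖w‖`. The right-hand side vanishes as soon as
`(e ^ (s L) - 1) (e ^ (L / n) - 1) = 1 - e ^ L`. For large `n` this equation is close to
`e ^ (s L) = n (1 - e ^ L) / L`, so its solutions are close to the points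
`(log n + 2πij) / s`, with an error `O(1 / s)`; these points become dense in the right half plane
as `s → ∞`. This is made precise, by the quantitative open mapping theorem, in
`exists_exp_solution`. Hence the possible values of `w` at zeros are dense in `1 ≤ ‖w‖`, and since
`z ↦ z + 1 + z⁻¹` is an open map on the punctured plane, the zeros themselves are dense in the
preimage of this region.
-/

namespace YamadaPolynomial

section Combinatorics

open Finset

/-! ### Components of subgraphs of a cycle -/

/-- The graph with an edge from `x` to `f x` for every `x ∈ T` has one component for each point
outside `T`, provided that every orbit of `f` leaves `T`: following `f` until it leaves `T` is
constant on components, and it picks out exactly one point of `Tᶜ` in each of them. -/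
theorem card_quot_of_iterate {α : Type*} (f : α → α) (T : Set α)
    (h : ∀ x, ∃ k, f^[k] x ∉ T) :
    Nat.card (Quot fun x y => (x ∈ T ∧ y = f x) ∨ (y ∈ T ∧ x = f y)) = Nat.card ↥Tᶜ := by
  classical
  set r : α → α → Prop := fun x y => (x ∈ T ∧ y = f x) ∨ (y ∈ T ∧ x = f y) with hr
  let e : α → ↥Tᶜ := fun x => ⟨f^[Nat.find (h x)] x, Nat.find_spec (h x)⟩
  have e_step : ∀ x ∈ T, e x = e (f x) := by
    intro x hx
    have h' : ∃ k, f^[k + 1] x ∉ T := by simpa using h (f x)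
    have : Nat.find (h x) = Nat.find h' + 1 := Nat.find_comp_succ (h x) h' (by simpa using hx)
    apply Subtype.ext
    change f^[Nat.find (h x)] x = _
    rw [this]
    rfl
  have e_self : ∀ x : ↥Tᶜ, e x = x := by
    intro x
    have : Nat.find (h x) = 0 := (Nat.find_eq_zero _).2 x.2
    apply Subtype.ext
    change f^[Nat.find (h x)] (x : α) = x
    rw [this]
    rfl
  have walk : ∀ k x, (∀ j < k, f^[j] x ∈ T) → Quot.mk r (f^[k] x) = Quot.mk r x := by
    intro k
    induction k with
    | zero => intro x _; rfl
    | succ k ih =>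
      intro x hx
      rw [← ih x fun j hj => hx j (by lia), Function.iterate_succ_apply']
      have hstep : r (f^[k] x) (f (f^[k] x)) := Or.inl ⟨hx k (by lia), rfl⟩
      exact (Quot.sound hstep).symm
  refine Nat.card_congr
    { toFun := Quot.lift e ?_
      invFun := fun x => Quot.mk r x
      left_inv := ?_
      right_inv := e_self }
  · rintro x y (⟨hx, rfl⟩ | ⟨hy, rfl⟩)
    · exact e_step x hx
    · exact (e_step y hy).symm
  · rintro ⟨x⟩
    exact walk _ x fun j hj => not_not.1 (Nat.find_min (h x) hj)

open Fin.NatCast in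
theorem exists_iterate_finRotate {n : ℕ} (x y : Fin n) : ∃ k, (finRotate n)^[k] x = y := by
  have : NeZero n := x.neZero
  have key : ∀ k : ℕ, (finRotate n)^[k] x = x + (k : Fin n) := by
    intro k
    induction k with
    | zero => simp
    | succ k ih =>
      rw [Function.iterate_succ_apply', ih, finRotate_apply, add_assoc]
      congr 1
      simp
  exact ⟨(y - x : Fin n).val, by rw [key]; simp⟩

/-- The number of components of the spanning subgraph of the cycle `C_n` with edge set `T`. -/
theorem card_quot_finRotate {n : ℕ} (hn : 1 ≤ n) (T : Finset (Fin n)) :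
    Nat.card (Quot fun x y => (x ∈ T ∧ y = finRotate n x) ∨ (y ∈ T ∧ x = finRotate n y)) =
      if T = univ then 1 else n - #T := by
  split_ifs with hT
  · subst hT
    have : NeZero n := ⟨by lia⟩
    refine Nat.card_eq_one_iff_exists.2 ⟨Quot.mk _ 0, ?_⟩
    rintro ⟨x⟩
    obtain ⟨k, rfl⟩ := exists_iterate_finRotate 0 x
    induction k with
    | zero => rfl
    | succ k ih =>
      rw [← ih, Function.iterate_succ_apply', eq_comm]
      apply Quot.sound
      exact Or.inl ⟨mem_univ _, rfl⟩
  · obtain ⟨y, hy⟩ : ∃ y, y ∉ T := by simpa [eq_univ_iff_forall] using hT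
    refine (card_quot_of_iterate (finRotate n) (T : Set (Fin n)) fun x => ?_).trans ?_
    · obtain ⟨k, rfl⟩ := exists_iterate_finRotate x y
      exact ⟨k, hy⟩
    · rw [← coe_compl, Nat.card_coe_set_eq, Set.ncard_coe_finset, card_compl, Fintype.card_fin]

/-! ### The ring of beads and its Yamada polynomial -/

theorem ringOfBeads_isLink {n s : ℕ} {f : Fin n × Fin s} {p q : Fin n ⊕ (Fin n × Fin 2)} :
    (ringOfBeads n s).IsLink f p q ↔
      (p = Sum.inl f.1 ∧ q = Sum.inl (finRotate n f.1)) ∨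
        (p = Sum.inl (finRotate n f.1) ∧ q = Sum.inl f.1) := by
  simp only [ringOfBeads, replaceEdges, cycleGraph, thetaGraph, Graph.banana_isLink, Set.mem_univ,
    true_and]
  constructor
  · rintro ⟨x, y, ⟨rfl, rfl⟩ | ⟨rfl, rfl⟩, rfl, rfl⟩ <;> simp [attach]
  · rintro (⟨rfl, rfl⟩ | ⟨rfl, rfl⟩)
    · exact ⟨0, 1, by simp [attach]⟩
    · exact ⟨1, 0, by simp [attach]⟩

theorem ringOfBeads_edgeSet (n s : ℕ) : (ringOfBeads n s).edgeSet = Set.univ := by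
  refine Set.eq_univ_of_forall fun f => ?_
  exact (ringOfBeads_isLink.2 (Or.inl ⟨rfl, rfl⟩)).edge_mem

theorem ringOfBeads_vertexSet (n s : ℕ) :
    (ringOfBeads n s).vertexSet = Set.range Sum.inl := by
  simp only [ringOfBeads, replaceEdges, cycleGraph, Set.image_univ]
  rw [Set.union_eq_left]
  rintro _ ⟨⟨i, j⟩, ⟨-, -, h0, h1⟩, rfl⟩
  fin_cases j <;> simp_all

/-- The number of components of a spanning subgraph of the ring of beads depends only on the set `T`
of beads that keep at least one edge. -/
theorem numComponents_ringOfBeads_deleteEdges {n s : ℕ} (hn : 1 ≤ n)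
    (F : Finset (Fin n × Fin s)) (T : Finset (Fin n)) (hT : ∀ i, i ∈ T ↔ ∃ j, (i, j) ∉ F) :
    numComponents ((ringOfBeads n s).deleteEdges (F : Set (Fin n × Fin s))) =
      if T = univ then 1 else n - #T := by
  rw [← card_quot_finRotate hn]
  have hV : ((ringOfBeads n s).deleteEdges (F : Set (Fin n × Fin s))).vertexSet =
    Set.range Sum.inl := ringOfBeads_vertexSet n s
  let e : Fin n ≃ ((ringOfBeads n s).deleteEdges (F : Set (Fin n × Fin s))).vertexSet :=
    (Equiv.ofInjective Sum.inl Sum.inl_injective).trans (Equiv.setCongr hV.symm)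
  have he : ∀ x, (e x : Fin n ⊕ (Fin n × Fin 2)) = Sum.inl x := fun x => rfl
  refine (Nat.card_congr (Quot.congr e fun x y => ?_)).symm
  simp only [he, Graph.Adj, Graph.deleteEdges_isLink, ringOfBeads_isLink, hT, Prod.exists,
    Sum.inl.injEq, mem_coe]
  constructor
  · rintro (⟨⟨j, hj⟩, rfl⟩ | ⟨⟨j, hj⟩, rfl⟩)
    · exact ⟨x, j, Or.inl ⟨rfl, rfl⟩, hj⟩
    · exact ⟨y, j, Or.inr ⟨rfl, rfl⟩, hj⟩
  · rintro ⟨i, j, ⟨rfl, rfl⟩ | ⟨rfl, rfl⟩, hj⟩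
    · exact Or.inl ⟨⟨j, hj⟩, rfl⟩
    · exact Or.inr ⟨⟨j, hj⟩, rfl⟩

/-- The sets `F` of removed edges of the ring of beads correspond to the families giving, for each
bead `i`, the set of its surviving edges `j`, those with `(i, j) ∉ F`. -/
def survivingEquiv (n s : ℕ) : Finset (Fin n × Fin s) ≃ (Fin n → Finset (Fin s)) where
  toFun F i := {j | (i, j) ∉ F}
  invFun g := {p | p.2 ∉ g p.1}
  left_inv F := by ext; simp
  right_inv g := by ext; simp

theorem card_add_sum_card_survivingEquiv {n s : ℕ} (F : Finset (Fin n × Fin s)) :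
    #F + ∑ i, #(survivingEquiv n s F i) = n * s := by
  have h : #Fᶜ = ∑ i, #(survivingEquiv n s F i) := by
    rw [card_eq_sum_card_fiberwise (f := Prod.fst) (t := univ) (by simp)]
    refine sum_congr rfl fun i _ => ?_
    refine card_nbij' Prod.snd (fun j => (i, j)) ?_ ?_ ?_ ?_ <;>
      simp +contextual [Set.MapsTo, Set.LeftInvOn, survivingEquiv]
    rintro a b h rfl
    exact h
  rw [← h, card_add_card_compl]; simp

/-- Multiplied by `y ^ n`, the sum defining `h(C_n(Θ_s))(-1, y)` splits into two sums of products
over the beads. With `q = -y`, a spanning subgraph with set `T` of nonempty beads has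
`q ^ μ = q ^ (n - |T|) + [T = univ] (q - 1)`, and both terms factor over the beads. -/
theorem negami_ringOfBeads {n s : ℕ} (hn : 1 ≤ n) {R : Type*} [CommRing R] (y : R) :
    y ^ n * negamiPolynomial (ringOfBeads n s) (-1 : Rˣ) y =
      ((1 + y) ^ s - 1 - y) ^ n - (1 + y) * ((1 + y) ^ s - 1) ^ n := by
  have term : ∀ F : Finset (Fin n × Fin s),
      y ^ n * ((-1) ^ numComponents ((ringOfBeads n s).deleteEdges (F : Set (Fin n × Fin s))) *
        y ^ bettiNumber ((ringOfBeads n s).deleteEdges (F : Set (Fin n × Fin s)))) =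
      (∏ i, if survivingEquiv n s F i = ∅ then -y else y ^ #(survivingEquiv n s F i)) -
        (1 + y) * ∏ i, if survivingEquiv n s F i = ∅ then 0 else y ^ #(survivingEquiv n s F i) := by
    intro F
    set g := survivingEquiv n s F with hg
    set T : Finset (Fin n) := {i | g i ≠ ∅} with hTdef
    have hT : ∀ i, i ∈ T ↔ ∃ j, (i, j) ∉ F := by
      intro i
      simp [hTdef, hg, survivingEquiv, filter_eq_empty_iff]
    have hcomp := numComponents_ringOfBeads_deleteEdges hn F T hT
    have hcard := card_add_sum_card_survivingEquiv F
    rw [← hg] at hcard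
    have hTle : #T ≤ ∑ i, #(g i) := by
      rw [card_eq_sum_ones]
      refine (sum_le_sum fun i hi => ?_).trans (sum_le_sum_of_subset (subset_univ T))
      exact card_pos.2 (nonempty_iff_ne_empty.2 (by simpa [hTdef] using hi))
    have hTn : #T ≤ n := by simpa using card_le_univ T
    have hbetti : n + bettiNumber ((ringOfBeads n s).deleteEdges (F : Set (Fin n × Fin s))) =
        ∑ i, #(g i) + numComponents ((ringOfBeads n s).deleteEdges (F : Set (Fin n × Fin s))) := by
      have hV : ((ringOfBeads n s).deleteEdges (F : Set (Fin n × Fin s))).vertexSet.ncard = n := by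
        rw [Graph.vertexSet_deleteEdges, ringOfBeads_vertexSet,
          Set.ncard_range_of_injective Sum.inl_injective]
        simp
      have hE : ((ringOfBeads n s).deleteEdges (F : Set (Fin n × Fin s))).edgeSet.ncard =
          ∑ i, #(g i) := by
        rw [Graph.edgeSet_deleteEdges, ringOfBeads_edgeSet, ← Set.compl_eq_univ_sdiff, ← coe_compl,
          Set.ncard_coe_finset, card_compl]
        simp
        lia
      rw [bettiNumber, hV, hE]
      -- The subtraction in `bettiNumber` is not truncated.
      have : n ≤ ∑ i, #(g i) +
          numComponents ((ringOfBeads n s).deleteEdges (F : Set (Fin n × Fin s))) := by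
        rw [hcomp]
        split_ifs with h
        · rw [h, card_univ, Fintype.card_fin] at hTle; lia
        · lia
      lia
    have hsum : ∏ i, y ^ #(g i) = y ^ ∑ i, #(g i) := prod_pow_eq_pow_sum _ _ _
    have hprod : (∏ i, if g i = ∅ then -y else y ^ #(g i)) =
        (-y) ^ (n - #T) * y ^ ∑ i, #(g i) := by
      have : ∀ i, (if g i = ∅ then -y else y ^ #(g i)) =
          (if i ∈ T then 1 else -y) * y ^ #(g i) := by
        intro i
        by_cases h : g i = ∅ <;> simp [hTdef, h]
      rw [prod_congr rfl fun i _ => this i, prod_mul_distrib, hsum, prod_ite]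
      simp [filter_not, ← compl_eq_univ_sdiff, card_compl]
    rw [mul_left_comm, ← pow_add, hbetti, hprod, hcomp]
    split_ifs with h
    · have h' : ∀ i, g i ≠ ∅ := fun i => by
        have := mem_univ i
        rw [← h] at this
        simpa [hTdef] using this
      simp only [h', if_false, hsum, h, card_univ, Fintype.card_fin]
      simp
      ring
    · obtain ⟨i, hi⟩ : ∃ i, g i = ∅ := by
        by_contra! h'
        exact h (by ext i; simp [hTdef, nonempty_iff_ne_empty.1 (h' i)])
      rw [prod_eq_zero (mem_univ i) (by simp [hi]), neg_pow y]
      ring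
  -- The contribution of one bead, in which an empty bead has weight `c`.
  have hsum : ∀ c : R, ∑ A : Finset (Fin s), (if A = ∅ then c else y ^ #A) =
      (1 + y) ^ s - 1 + c := by
    intro c
    have h1 : ∑ A : Finset (Fin s), y ^ #A = (1 + y) ^ s := by
      have := sum_pow_mul_eq_add_pow y 1 (univ : Finset (Fin s))
      simp only [one_pow, mul_one, powerset_univ, card_univ, Fintype.card_fin] at this
      rw [this, add_comm]
    have h2 : ∀ A : Finset (Fin s), (if A = ∅ then c else y ^ #A) =
        y ^ #A + if A = ∅ then c - 1 else 0 := by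
      intro A
      split_ifs with h <;> simp [h]
    rw [sum_congr rfl fun A _ => h2 A, sum_add_distrib, h1, sum_ite_eq' univ]
    simp
    ring
  have hedge : (Set.toFinite (ringOfBeads n s).edgeSet).toFinset = univ := by
    ext; simp [ringOfBeads_edgeSet]
  rw [negamiPolynomial, hedge, powerset_univ, mul_sum]
  simp only [neg_neg, inv_one, one_pow, Units.val_one, one_mul, Units.val_neg]
  rw [sum_congr rfl fun F _ => term F, (survivingEquiv n s).sum_comp fun g : Fin n → Finset (Fin s) =>
    (∏ i, if g i = ∅ then -y else y ^ #(g i)) - (1 + y) * ∏ i, if g i = ∅ then 0 else y ^ #(g i),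
    sum_sub_distrib, ← mul_sum]
  have hpi : ∀ c : R, ∑ g : Fin n → Finset (Fin s), ∏ i, (if g i = ∅ then c else y ^ #(g i)) =
      ((1 + y) ^ s - 1 + c) ^ n := by
    intro c
    rw [← hsum c, ← Fintype.piFinset_univ, sum_prod_piFinset univ
      fun (_ : Fin n) (A : Finset (Fin s)) => if A = ∅ then c else y ^ #A]
    simp
  rw [hpi, hpi]
  simp [sub_eq_add_neg]

theorem eval₂_yamadaPolynomial {α β : Type*} [Finite β] (G : Graph α β) (z : ℂˣ) :
    LaurentPolynomial.eval₂ (Int.castRingHom ℂ) z (yamadaPolynomial G) =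
      negamiPolynomial G (-1 : ℂˣ) (-(z : ℂ) - 2 - (z : ℂ)⁻¹) := by
  simp only [yamadaPolynomial, negamiPolynomial, map_sum, map_mul, map_pow, map_sub, map_neg,
    neg_neg, inv_one, one_pow, Units.val_one, map_one, Units.val_neg, LaurentPolynomial.eval₂_T, map_ofNat]
  simp

/-- In terms of `w = z + 1 + z⁻¹ = -(y + 1)`, zeros of the Yamada polynomial of the ring of beads
come from zeros of `((-w) ^ s + w) ^ n + w ((-w) ^ s - 1) ^ n`. The exclusion of `w = -1`, that is
of `y = 0`, makes it possible to cancel `y ^ n`. -/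
theorem mem_yamadaZeros_ringOfBeads {n s : ℕ} (hn : 1 ≤ n) {z w : ℂ} (hz : z ≠ 0)
    (hw : w = z + 1 + z⁻¹) (hw1 : w ≠ -1)
    (h : ((-w) ^ s + w) ^ n + w * ((-w) ^ s - 1) ^ n = 0) :
    z ∈ yamadaZeros (ringOfBeads n s) := by
  refine ⟨Units.mk0 z hz, rfl, ?_⟩
  rw [eval₂_yamadaPolynomial]
  have hy : -z - 2 - z⁻¹ = -(w + 1) := by rw [hw]; ring
  have hy0 : -(w + 1) ≠ 0 := fun h0 => hw1 (by linear_combination -h0)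
  have key := negami_ringOfBeads (s := s) hn (-(w + 1))
  rw [show 1 + -(w + 1) = -w by ring] at key
  rw [Units.val_mk0, hy]
  refine (mul_eq_zero.1 (key.trans ?_)).resolve_left (pow_ne_zero n hy0)
  rw [← h]
  ring

end Combinatorics

section Analysis

open Filter Topology Metric

/-! ### Solutions of the exponential equation -/

/-- With `w = -e ^ L`, the equation `((-w) ^ s + w) ^ n + w ((-w) ^ s - 1) ^ n = 0` follows from
`(-w) ^ s + w = e ^ (L / n) ((-w) ^ s - 1)`, because `(e ^ (L / n)) ^ n = -w`. -/
theorem eq_zero_of_exp {n s : ℕ} (hn : n ≠ 0) {L : ℂ}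
    (h : (Complex.exp (s * L) - 1) * (Complex.exp (L / n) - 1) = 1 - Complex.exp L) :
    ((-(-Complex.exp L)) ^ s + -Complex.exp L) ^ n +
      -Complex.exp L * ((-(-Complex.exp L)) ^ s - 1) ^ n = 0 := by
  have hroot : Complex.exp (L / n) ^ n = Complex.exp L := by
    rw [← Complex.exp_nat_mul]
    congr 1
    field_simp
  rw [neg_neg, ← Complex.exp_nat_mul,
    show Complex.exp (s * L) + -Complex.exp L =
      Complex.exp (L / n) * (Complex.exp (s * L) - 1) by linear_combination -h, mul_pow, hroot]
  ring

theorem dslope_exp_zero_mul (x : ℂ) : x * dslope Complex.exp 0 x = Complex.exp x - 1 := by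
  simpa using sub_smul_dslope Complex.exp 0 x

theorem differentiable_dslope_exp_zero : Differentiable ℂ (dslope Complex.exp 0) := by
  rw [← differentiableOn_univ, Complex.differentiableOn_dslope univ_mem]
  exact Complex.differentiable_exp.differentiableOn

/-- The equation `L = a + ψ(L) / s` with bounded holomorphic `ψ` is solvable near `L₀` when `s` is
large and `a` is close to `L₀`, by the quantitative open mapping theorem for `L ↦ s L - ψ(L)`. -/
theorem exists_solution_near {ψ : ℂ → ℂ} {L₀ a : ℂ} {r s : ℝ} (hr : 0 < r)
    (hψ : DiffContOnCl ℂ ψ (ball L₀ r)) (hψ1 : ∀ L ∈ closedBall L₀ r, ‖ψ L‖ ≤ 1) (hs : 0 < s)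
    (hrs : 8 ≤ r * s) (ha : ‖s * (L₀ - a)‖ < r * s / 8) :
    ∃ L ∈ closedBall L₀ r, s * L = a * s + ψ L := by
  have hsC : (s : ℂ) ≠ 0 := by exact_mod_cast hs.ne'
  set φ : ℂ → ℂ := fun L => s * L - ψ L with hφ
  have hφd : DiffContOnCl ℂ φ (ball L₀ r) :=
    ((differentiable_id.const_mul (s : ℂ)).diffContOnCl).sub hψ
  have hbound : ∀ z ∈ closedBall L₀ r, s * ‖z - L₀‖ - 2 ≤ ‖φ z - φ L₀‖ := by
    intro z hz
    have h1 : φ z - φ L₀ = s * (z - L₀) - (ψ z - ψ L₀) := by simp only [hφ]; ring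
    have h2 : ‖(s : ℂ) * (z - L₀)‖ = s * ‖z - L₀‖ := by
      rw [norm_mul, Complex.norm_real, Real.norm_of_nonneg hs.le]
    have h3 : ‖ψ z - ψ L₀‖ ≤ 2 :=
      (norm_sub_le _ _).trans (by linarith [hψ1 z hz, hψ1 L₀ (mem_closedBall_self hr.le)])
    rw [h1]
    linarith [norm_sub_norm_le ((s : ℂ) * (z - L₀)) (ψ z - ψ L₀)]
  have hsphere : ∀ z ∈ sphere L₀ r, r * s / 2 ≤ ‖φ z - φ L₀‖ := by
    intro z hz
    have := hbound z (sphere_subset_closedBall hz)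
    rw [mem_sphere_iff_norm.1 hz] at this
    linarith
  have hne : ∃ᶠ z in 𝓝 L₀, φ z ≠ φ L₀ := by
    intro hconst
    simp only [ne_eq, not_not] at hconst
    have han : AnalyticOnNhd ℂ φ (ball L₀ r) := hφd.differentiableOn.analyticOnNhd isOpen_ball
    have heq : Set.EqOn φ (fun _ => φ L₀) (ball L₀ r) :=
      han.eqOn_of_preconnected_of_eventuallyEq analyticOnNhd_const
        (convex_ball L₀ r).isPreconnected (mem_ball_self hr) hconst
    have hz : L₀ + (r / 2 : ℝ) ∈ ball L₀ r := by
      rw [mem_ball_iff_norm, add_sub_cancel_left, Complex.norm_real,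
        Real.norm_of_nonneg (by positivity)]
      linarith
    have := hbound _ (ball_subset_closedBall hz)
    rw [heq hz, sub_self, norm_zero, add_sub_cancel_left, Complex.norm_real,
      Real.norm_of_nonneg (by positivity)] at this
    linarith
  obtain ⟨L, hL, hLa⟩ := hφd.ball_subset_image_closedBall hr hsphere hne
    (show a * s ∈ ball (φ L₀) (r * s / 2 / 2) by
      rw [mem_ball_iff_norm', show φ L₀ - a * s = s * (L₀ - a) - ψ L₀ by simp only [hφ]; ring]
      have := norm_sub_le ((s : ℂ) * (L₀ - a)) (ψ L₀)
      have := hψ1 L₀ (mem_closedBall_self hr.le)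
      linarith)
  exact ⟨L, hL, by rw [← hLa]; simp only [hφ]; ring⟩

/-- The equation `(e ^ (s L) - 1) (e ^ (L / n) - 1) = 1 - e ^ L` has solutions arbitrarily close to
every point `L₀` of the right half plane. It reads `e ^ (s L) = n Γ(1 / n, L)` for a function `Γ`
with `Γ(0, L₀) = c ≠ 0`; taking logarithms gives `s L = log n + log c + 2πij + ψ(L)` with `ψ`
bounded, where `n` and `j` can be chosen such that the constant is within `O(1)` of `s L₀`. -/
theorem exists_exp_solution {L₀ : ℂ} (hL₀ : 0 < L₀.re) {ε : ℝ} (hε : 0 < ε) :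
    ∃ n s : ℕ, 1 ≤ n ∧ 1 ≤ s ∧ ∃ L : ℂ, ‖L - L₀‖ < ε ∧ 0 < L.re ∧
      (Complex.exp (s * L) - 1) * (Complex.exp (L / n) - 1) = 1 - Complex.exp L := by
  have hL₀0 : L₀ ≠ 0 := by rintro rfl; simp at hL₀
  have hE0 : dslope Complex.exp 0 0 = 1 := by simp
  have hexp0 : 1 - Complex.exp L₀ ≠ 0 := by
    intro h
    have : ‖Complex.exp L₀‖ = 1 := by rw [← sub_eq_zero.1 h]; simp
    rw [Complex.norm_exp, Real.exp_eq_one_iff] at this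
    exact hL₀.ne' this
  set c : ℂ := (1 - Complex.exp L₀) / L₀ with hc
  have hc0 : c ≠ 0 := div_ne_zero hexp0 hL₀0
  -- `Γ (h, L) = h + h (1 - e ^ L) / (e ^ (h L) - 1)`, extended continuously to `h = 0`.
  set Γ : ℂ × ℂ → ℂ := fun p =>
    p.1 + (1 - Complex.exp p.2) / (p.2 * dslope Complex.exp 0 (p.1 * p.2)) with hΓ
  have hEc : Continuous (fun p : ℂ × ℂ => dslope Complex.exp 0 (p.1 * p.2)) :=
    differentiable_dslope_exp_zero.continuous.comp (continuous_fst.mul continuous_snd)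
  have hΓc : ContinuousAt Γ (0, L₀) := by
    refine continuousAt_fst.add (ContinuousAt.div ?_ ?_ ?_)
    · fun_prop
    · exact continuousAt_snd.mul hEc.continuousAt
    · simp [hL₀0]
  have hΓ0 : Γ (0, L₀) = c := by simp [hΓ, hc]
  have hev : ∀ᶠ p : ℂ × ℂ in 𝓝 (0, L₀), dslope Complex.exp 0 (p.1 * p.2) ≠ 0 ∧ 0 < p.2.re ∧
      ‖Γ p / c - 1‖ < 1 / 2 := by
    refine (hEc.continuousAt.eventually_ne (by simp)).and ((?_ : ∀ᶠ _ in _, _).and ?_)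
    · exact (Complex.continuous_re.comp continuous_snd).continuousAt.eventually (lt_mem_nhds hL₀)
    · have : ContinuousAt (fun p => ‖Γ p / c - 1‖) (0, L₀) :=
        ((hΓc.div_const c).sub continuousAt_const).norm
      exact this.eventually (gt_mem_nhds (by simp [hΓ0, hc0]))
  obtain ⟨δ, hδ, hball⟩ := Metric.eventually_nhds_iff.1 hev
  set r : ℝ := min (δ / 2) (ε / 2) with hr
  have hr0 : 0 < r := by positivity
  have hrδ : r < δ := (min_le_left _ _).trans_lt (by linarith)
  have hrε : r < ε := (min_le_right _ _).trans_lt (by linarith)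
  have hlim : Tendsto (fun s : ℕ => Real.exp (-(s * L₀.re))) atTop (𝓝 0) :=
    Real.tendsto_exp_neg_atTop_nhds_zero.comp
      (tendsto_natCast_atTop_atTop.atTop_mul_const hL₀)
  obtain ⟨s, hs1, hsδ, hsr⟩ := ((eventually_ge_atTop 1).and
    ((hlim.eventually (gt_mem_nhds hδ)).and ((tendsto_natCast_atTop_atTop.const_mul_atTop
      hr0).eventually (eventually_ge_atTop (8 * (8 + ‖Complex.log c‖)))))).exists
  have hs0 : (0 : ℝ) < s := by exact_mod_cast hs1
  -- The choice of `n` and `j` makes `log n + 2πij` approximate `s L₀` up to a bounded error.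
  set x : ℝ := Real.exp (s * L₀.re) with hx
  have hx1 : 1 ≤ x := Real.one_le_exp (by positivity)
  set n : ℕ := ⌈x⌉₊ with hn
  have hxn : x ≤ n := Nat.le_ceil x
  have hnx : (n : ℝ) ≤ 2 * x := by linarith [Nat.ceil_lt_add_one (zero_le_one.trans hx1)]
  have hn0 : (0 : ℝ) < n := by linarith
  have hn1 : 1 ≤ n := by exact_mod_cast hn0
  have hnC : (n : ℂ) ≠ 0 := by exact_mod_cast hn0.ne'
  have hsC : (s : ℂ) ≠ 0 := by exact_mod_cast hs0.ne'
  set h : ℂ := (n : ℂ)⁻¹ with hh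
  have hh0 : h ≠ 0 := inv_ne_zero hnC
  have hhδ : ‖h‖ < δ := by
    rw [hh, norm_inv, Complex.norm_natCast]
    refine lt_of_le_of_lt ?_ hsδ
    rw [Real.exp_neg]
    exact inv_anti₀ (Real.exp_pos _) hxn
  have hgood : ∀ L ∈ ball L₀ δ, dslope Complex.exp 0 (h * L) ≠ 0 ∧ 0 < L.re ∧
      ‖Γ (h, L) / c - 1‖ < 1 / 2 := by
    intro L hL
    refine hball (y := (h, L)) ?_
    rw [Prod.dist_eq]
    exact max_lt (by simpa using hhδ) hL
  have hsub : closedBall L₀ r ⊆ ball L₀ δ := closedBall_subset_ball hrδ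
  set ψ : ℂ → ℂ := fun L => Complex.log (Γ (h, L) / c) with hψ
  have hψd : DiffContOnCl ℂ ψ (ball L₀ r) := by
    refine DifferentiableOn.diffContOnCl (DifferentiableOn.mono (t := ball L₀ δ) ?_
      (closure_ball_subset_closedBall.trans hsub))
    intro L hL
    obtain ⟨hL1, hL2, hL3⟩ := hgood L hL
    have hL0 : L ≠ 0 := by rintro rfl; simp at hL2
    have hEd : DifferentiableAt ℂ (fun L => dslope Complex.exp 0 (h * L)) L :=
      (differentiable_dslope_exp_zero _).comp L (differentiableAt_id.const_mul h)
    refine DifferentiableAt.differentiableWithinAt (DifferentiableAt.clog ?_ ?_)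
    · refine DifferentiableAt.div_const (DifferentiableAt.const_add h (DifferentiableAt.div ?_
        (differentiableAt_id.mul hEd) (mul_ne_zero hL0 hL1))) c
      fun_prop
    · rw [← add_sub_cancel 1 (Γ (h, L) / c)]
      exact Complex.mem_slitPlane_of_norm_lt_one (by linarith)
  have hψ1 : ∀ L ∈ closedBall L₀ r, ‖ψ L‖ ≤ 1 := by
    intro L hL
    obtain ⟨-, -, hL3⟩ := hgood L (hsub hL)
    have := Complex.norm_log_one_add_half_le_self hL3.le
    rw [add_sub_cancel] at this
    exact this.trans (by linarith)
  set j : ℤ := round (s * L₀.im / (2 * Real.pi)) with hj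
  set a : ℂ := (Real.log n + Complex.log c + 2 * Real.pi * j * Complex.I) / s with ha
  have hre : |s * L₀.re - Real.log n| ≤ 1 := by
    have h1 : s * L₀.re ≤ Real.log n := by
      rw [Real.le_log_iff_exp_le hn0]; exact hxn
    have h2 : Real.log n ≤ Real.log 2 + s * L₀.re := by
      rw [← Real.log_exp (s * L₀.re), ← Real.log_mul (by norm_num) (Real.exp_pos _).ne']
      exact Real.log_le_log hn0 hnx
    rw [abs_le]
    constructor <;> linarith [Real.log_two_lt_d9]
  have him : |s * L₀.im - 2 * Real.pi * j| ≤ 4 := by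
    have h1 : s * L₀.im - 2 * Real.pi * j =
        2 * Real.pi * (s * L₀.im / (2 * Real.pi) - j) := by
      field_simp
    rw [h1, abs_mul, abs_of_pos Real.two_pi_pos]
    have := abs_sub_round (s * L₀.im / (2 * Real.pi))
    rw [← hj] at this
    nlinarith [Real.pi_lt_d2, Real.pi_pos]
  have hclose : ‖((s : ℝ) : ℂ) * (L₀ - a)‖ < r * s / 8 := by
    have h1 : ((s : ℝ) : ℂ) * (L₀ - a) = ((s * L₀.re - Real.log n : ℝ) : ℂ) +
        ((s * L₀.im - 2 * Real.pi * j : ℝ) : ℂ) * Complex.I - Complex.log c := by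
      have : ((s : ℝ) : ℂ) * a = Real.log n + Complex.log c + 2 * Real.pi * j * Complex.I := by
        rw [ha, Complex.ofReal_natCast, mul_div_cancel₀ _ hsC]
      rw [mul_sub, this]
      nth_rewrite 1 [← Complex.re_add_im L₀]
      push_cast
      ring
    rw [h1]
    refine (norm_sub_le _ _).trans_lt ?_
    refine (add_le_add_left (norm_add_le _ _) _).trans_lt ?_
    rw [norm_mul, Complex.norm_I, mul_one, Complex.norm_real, Complex.norm_real, Real.norm_eq_abs,
      Real.norm_eq_abs]
    linarith
  obtain ⟨L, hL, hLeq⟩ := exists_solution_near hr0 hψd hψ1 hs0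
    (by linarith [norm_nonneg (Complex.log c)]) hclose
  obtain ⟨hL1, hL2, hL3⟩ := hgood L (hsub hL)
  have hL0 : L ≠ 0 := by rintro rfl; simp at hL2
  refine ⟨n, s, hn1, hs1, L, (mem_closedBall_iff_norm.1 hL).trans_lt hrε, hL2, ?_⟩
  have hΓne : Γ (h, L) / c ≠ 0 := by
    intro h0
    rw [h0] at hL3
    norm_num at hL3
  have hmain : Complex.exp (s * L) = n * Γ (h, L) := by
    rw [Complex.ofReal_natCast] at hLeq
    rw [hLeq, ha, div_mul_cancel₀ _ hsC, Complex.exp_add, Complex.exp_add, Complex.exp_add,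
      Complex.exp_log hc0, hψ, Complex.exp_log hΓne, ← Complex.ofReal_exp, Real.exp_log hn0,
      show 2 * (Real.pi : ℂ) * j * Complex.I = j * (2 * Real.pi * Complex.I) by ring,
      Complex.exp_int_mul_two_pi_mul_I, Complex.ofReal_natCast]
    field_simp
  have hEeq : Complex.exp (L / n) - 1 = h * L * dslope Complex.exp 0 (h * L) := by
    rw [dslope_exp_zero_mul, hh]
    congr 2
    rw [div_eq_inv_mul]
  have hnh : (n : ℂ) * h = 1 := mul_inv_cancel₀ hnC
  have hquot : (1 - Complex.exp L) / (L * dslope Complex.exp 0 (h * L)) *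
      (L * dslope Complex.exp 0 (h * L)) = 1 - Complex.exp L :=
    div_mul_cancel₀ _ (mul_ne_zero hL0 hL1)
  rw [hmain, hEeq, hΓ]
  linear_combination (h * L * dslope Complex.exp 0 (h * L) + (1 - Complex.exp L)) * hnh +
    n * h * hquot

/-! ### Passing from `w` to `z` -/

/-- The map `z ↦ z + 1 + z⁻¹` is open at `z₀ ≠ 0`: its fibres are finite, so it is not locally
constant. -/
theorem nhds_le_map_add_one_add_inv {z₀ : ℂ} (hz₀ : z₀ ≠ 0) :
    𝓝 (z₀ + 1 + z₀⁻¹) ≤ map (fun z : ℂ => z + 1 + z⁻¹) (𝓝 z₀) := by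
  have han : AnalyticAt ℂ (fun z : ℂ => z + 1 + z⁻¹) z₀ :=
    (analyticAt_id.add analyticAt_const).add (analyticAt_id.inv hz₀)
  refine han.eventually_constant_or_nhds_le_map_nhds.resolve_left fun hconst => ?_
  have hsub : ({z₀, z₀⁻¹} : Set ℂ) ∈ 𝓝 z₀ := by
    filter_upwards [hconst, isOpen_ne.mem_nhds hz₀] with z hz hz0
    have hz0 : z ≠ 0 := hz0
    have : (z - z₀) * (z - z₀⁻¹) = 0 := by
      field_simp at hz ⊢
      linear_combination hz
    rcases mul_eq_zero.1 this with h | h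
    · exact Or.inl (sub_eq_zero.1 h)
    · exact Or.inr (sub_eq_zero.1 h)
  exact (infinite_of_mem_nhds z₀ hsub) (Set.toFinite _)

theorem exists_one_lt_norm_near {w₀ : ℂ} (hw₀ : 1 ≤ ‖w₀‖) {U : Set ℂ} (hU : U ∈ 𝓝 w₀) :
    ∃ w ∈ U, 1 < ‖w‖ := by
  have hlim : Tendsto (fun t : ℝ => (t : ℂ) * w₀) (𝓝[>] 1) (𝓝 w₀) := by
    have : Continuous (fun t : ℝ => (t : ℂ) * w₀) := by fun_prop
    simpa using this.continuousWithinAt (s := Set.Ioi (1 : ℝ)) (x := 1) |>.tendsto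
  obtain ⟨t, htU, ht⟩ := ((hlim.eventually hU).and self_mem_nhdsWithin).exists
  have ht : 1 < t := ht
  refine ⟨_, htU, ?_⟩
  rw [norm_mul, Complex.norm_real, Real.norm_of_nonneg (by linarith)]
  nlinarith

end Analysis

end YamadaPolynomial

open YamadaPolynomial Filter Topology Metric in
theorem theorem6p3 :
    {z : ℂ | z ≠ 0 ∧ 1 ≤ ‖z + 1 + z⁻¹‖} ⊆
      closure {z : ℂ | ∃ n s : ℕ, 1 ≤ n ∧ 1 ≤ s ∧
        z ∈ YamadaPolynomial.yamadaZeros (YamadaPolynomial.ringOfBeads n s)} := by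
  rintro z₀ ⟨hz₀, hw₀⟩
  rw [mem_closure_iff_nhds]
  intro V hV
  have himage : (fun z : ℂ => z + 1 + z⁻¹) '' (V ∩ {0}ᶜ) ∈ 𝓝 (z₀ + 1 + z₀⁻¹) :=
    nhds_le_map_add_one_add_inv hz₀
      (image_mem_map (inter_mem hV (isOpen_compl_singleton.mem_nhds hz₀)))
  -- The boundary `‖w‖ = 1` is covered too: only a nearby point with `‖w₁‖ > 1` is needed.
  obtain ⟨w₁, hw₁, hw₁n⟩ := exists_one_lt_norm_near hw₀ (interior_mem_nhds.2 himage)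
  have hw₁0 : -w₁ ≠ 0 := by
    rw [neg_ne_zero]
    rintro rfl
    norm_num at hw₁n
  have hre : 0 < (Complex.log (-w₁)).re := by
    rw [Complex.log_re, norm_neg]
    exact Real.log_pos hw₁n
  have hcont : ContinuousAt (fun L => -Complex.exp L) (Complex.log (-w₁)) := by fun_prop
  have hpre := hcont.preimage_mem_nhds (t := interior ((fun z : ℂ => z + 1 + z⁻¹) '' (V ∩ {0}ᶜ)))
    (by rw [Complex.exp_log hw₁0, neg_neg]; exact isOpen_interior.mem_nhds hw₁)
  obtain ⟨ε, hε, hball⟩ := Metric.mem_nhds_iff.1 hpre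
  obtain ⟨n, s, hn, hs, L, hL, hLre, hLeq⟩ := exists_exp_solution hre hε
  obtain ⟨z, ⟨hzV, hz0⟩, hz⟩ := interior_subset (hball (mem_ball_iff_norm.2 hL))
  refine ⟨z, hzV, n, s, hn, hs,
    mem_yamadaZeros_ringOfBeads hn hz0 hz.symm ?_ (eq_zero_of_exp (by lia) hLeq)⟩
  intro h1
  have : ‖Complex.exp L‖ = 1 := by rw [neg_inj.1 h1, norm_one]
  rw [Complex.norm_exp, Real.exp_eq_one_iff] at this
  exact hLre.ne' this
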